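/- Machine model. A nondeterministic Turing machine has a two-way read-only input tape holding $x\in\{0,1\}^*$ between end markers, finitely many two-way infinite read-write work tapes over a finite alphabet, finitely many states, and distinct accept and reject states; a computation stops exactly when it enters one of these two. A computation path on $x$ is a sequence of configurations that starts in the initial configuration and in which each configuration is a possible successor of the previous one; it is accepting (rejecting) if it ends in the accept (reject) state. A machine halts if it has no infinite computation path on any input; it then has finitely many paths on each input. A machine uses memory at most $m:\mathbb N\to\mathbb N$ if on every input of length $n$ at most $m(n)$ work-tape cells, counted over all work tapes, are scanned along any computation path. Fix a prime $p$. For a halting machine $T$, let $\mathcal F(T):\{0,1\}^*\to\{0,1\}$ take the value $1$ at $x$ if the number of accepting paths of $T$ on $x$ is nonzero modulo $p$, and $0$ otherwise. **Lemma.** Let $p$ be a prime, let $T$ be a halting nondeterministic Turing machine that uses memory at most $m$, where $m(n)=\Omega(\log n)$, and let $f=\mathcal F(T)$. Then there is a halting nondeterministic Turing machine $T'$ that uses memory at most $m'$ for some $m'=O(m)$, such that $f=\mathcal F(T')$ and, for every $x\in\{0,1\}^*$, $$\#\{\text{accepting paths of }T'\text{ on }x\}\equiv f(x)\pmod p,\qquad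 \#\{\text{rejecting paths of }T'\text{ on }x\}\equiv 1-f(x)\pmod p.$$ -/

import Mathlib

/-- The symbols that can be read on the read-only input tape: the two end markers and the bits. -/
inductive InSym : Type
  | leftEnd
  | bit (b : Bool)
  | rightEnd

/-- Head movements. -/
inductive Move : Type
  | left
  | stay
  | right

/-- Displacement of a head on a two-way infinite work tape. -/
def Move.shift : Move → ℤ
  | Move.left => -1
  | Move.stay => 0
  | Move.right => 1

/-- Movement of the head on the input tape, whose cells are numbered `0, …, n + 1`
(`0` and `n + 1` hold the end markers). A move beyond an end marker leaves the head in place. -/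
def Move.inShift (n : ℕ) : Move → ℕ → ℕ
  | Move.left, i => i - 1
  | Move.stay, i => i
  | Move.right, i => min (i + 1) (n + 1)

/-- The symbol in cell `i` of the input tape that holds `⊢ x ⊣`. -/
def inputSymbol (x : List Bool) : ℕ → InSym
  | 0 => InSym.leftEnd
  | i + 1 => match x[i]? with
    | some b => InSym.bit b
    | none => InSym.rightEnd

/-- A nondeterministic Turing machine with a read-only two-way input tape, and finitely many
read-write two-way infinite work tapes (indexed by `ι`). A computation stops as soon as it enters
the accept or the reject state; in every other state at least one instruction is applicable. -/
structure NTM where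
  /-- control states -/
  Q : Type
  finQ : Finite Q
  /-- work tape alphabet -/
  Γ : Type
  finΓ : Finite Γ
  blank : Γ
  /-- names of the work tapes -/
  ι : Type
  finι : Finite ι
  start : Q
  acc : Q
  rej : Q
  acc_ne_rej : acc ≠ rej
  /-- `tr q a g` is the set of instructions applicable in state `q` when `a` is scanned on the input
  tape and `g i` on work tape `i`. An instruction consists of the next state, the input head
  movement, and for each work tape the symbol to be written and the head movement. -/
  tr : Q → InSym → (ι → Γ) → Set (Q × Move × (ι → Γ × Move))
  tr_nonempty : ∀ q a g, q ≠ acc → q ≠ rej → (tr q a g).Nonempty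

namespace NTM

/-- Configurations of the machine (the input itself is fixed during a computation). -/
@[ext] structure Cfg (T : NTM) where
  state : T.Q
  inPos : ℕ
  tape : T.ι → ℤ → T.Γ
  head : T.ι → ℤ

/-- Initial configuration: start state, input head on the left end marker, blank work tapes. -/
def init (T : NTM) : T.Cfg where
  state := T.start
  inPos := 0
  tape := fun _ _ => T.blank
  head := fun _ => 0

/-- The result of executing an instruction on input `x`. -/
def exec (T : NTM) (x : List Bool) (c : T.Cfg) (a : T.Q × Move × (T.ι → T.Γ × Move)) : T.Cfg where
  state := a.1
  inPos := a.2.1.inShift x.length c.inPos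
  tape := fun i => Function.update (c.tape i) (c.head i) (a.2.2 i).1
  head := fun i => c.head i + (a.2.2 i).2.shift

/-- `T.Step x c c'`: on input `x`, configuration `c'` is a possible successor of `c`. -/
def Step (T : NTM) (x : List Bool) (c c' : T.Cfg) : Prop :=
  c.state ≠ T.acc ∧ c.state ≠ T.rej ∧
    ∃ a ∈ T.tr c.state (inputSymbol x c.inPos) (fun i => c.tape i (c.head i)), c' = T.exec x c a

/-- A (partial) computation path on input `x`: a finite sequence of configurations that begins with
the initial configuration, each one being a possible successor of the one before it. -/
def IsPath (T : NTM) (x : List Bool) (l : List T.Cfg) : Prop :=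
  l.head? = some T.init ∧ l.IsChain (T.Step x)

/-- The computation paths on input `x` that end in state `q`. -/
def pathsTo (T : NTM) (x : List Bool) (q : T.Q) : Set (List T.Cfg) :=
  {l | T.IsPath x l ∧ ∃ c, l.getLast? = some c ∧ c.state = q}

/-- The number of accepting paths on input `x`. -/
noncomputable def numAccept (T : NTM) (x : List Bool) : ℕ := (T.pathsTo x T.acc).ncard

/-- The number of rejecting paths on input `x`. -/
noncomputable def numReject (T : NTM) (x : List Bool) : ℕ := (T.pathsTo x T.rej).ncard

/-- On every input the computation tree of `T` is finite. As `T` is finitely branching, this says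
that `T` has no infinite computation path. -/
def Halts (T : NTM) : Prop :=
  ∀ x : List Bool, ∃ t : ℕ, ∀ l, T.IsPath x l → l.length ≤ t

/-- `T` uses memory at most `m`: on inputs of length `n`, at most `m n` work tape cells (counted over
all work tapes) are scanned along any computation path. -/
def UsesMemory (T : NTM) (m : ℕ → ℕ) : Prop :=
  ∀ (x : List Bool) (l : List T.Cfg), T.IsPath x l →
    {z : T.ι × ℤ | ∃ c ∈ l, c.head z.1 = z.2}.ncard ≤ m x.length

/-- The `{0, 1}`-valued function computed by `T` by counting accepting paths modulo `p`: the value is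
`1` if the number of accepting paths is nonzero modulo `p`, and `0` otherwise. -/
noncomputable def modFun (p : ℕ) (T : NTM) : List Bool → ℕ :=
  fun x => if T.numAccept x % p ≠ 0 then 1 else 0

end NTM

/-! Let N be the number of accepting paths of `T` on x, and p = n + 1. By Fermat, N^n is f(x) modulo
p (`cast_modFun`), so it suffices to find a machine with N^n accepting and 1 - N^n rejecting paths
modulo p. This is `T.pow n`. Running `T` n times, each run starting only after the previous one
accepts, gives N^n ways for all runs to accept. A run that rejects splits into p rejecting paths,
which contribute 0. A guess k among p values, with acceptance only for k = 0, gives N^n accepting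
and n * N^n = -N^n rejecting paths; one path that rejects at once supplies the 1.

In `run k r q`, the index r names the copy of the work tapes in use. It counts down from n, and r =
0 means that all runs have accepted. Each run has a fresh copy, so nothing is erased and memory
grows only by the constant factor p. The count rests on `pow_hasCount_liftCfg`, an induction along
the computation tree of `T`; the memory bound rests on `exists_isPath_of_pow_isPath`, which projects
a path to each copy. -/

/-! ### Counting the branches of a bounded tree -/

/-- The chains of `R` that begin with `a` and end in an element satisfying `P`. -/
def chainsTo {α : Type*} (R : α → α → Prop) (P : α → Prop) (a : α) : Set (List α) :=
  {l | l.head? = some a ∧ l.IsChain R ∧ ∃ c, l.getLast? = some c ∧ P c}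

/-- All chains of `R` that begin with `a` have length at most `t`. -/
def ChainsBounded {α : Type*} (R : α → α → Prop) (a : α) (t : ℕ) : Prop :=
  ∀ l : List α, l.head? = some a → l.IsChain R → l.length ≤ t

/-- The tree of chains of `R` from `a` is bounded, and it has finitely many branches that end in
an element satisfying `P`; their number is `v`, as an element of the semiring `M`. -/
structure HasCount {α M : Type*} [Semiring M] (R : α → α → Prop) (P : α → Prop) (a : α) (v : M) :
    Prop where
  bounded : ∃ t, ChainsBounded R a t
  finite : (chainsTo R P a).Finite
  card : ((chainsTo R P a).ncard : M) = v

section Chains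

variable {α M : Type*} [Semiring M] {R : α → α → Prop} {P : α → Prop} {a b : α}

theorem ChainsBounded.pos {t : ℕ} (h : ChainsBounded R a t) : 0 < t := by
  exact h [a] rfl (by simp)

theorem ChainsBounded.of_step {t : ℕ} (h : ChainsBounded R a (t + 1)) (hab : R a b) :
    ChainsBounded R b t := by
  intro l hl hc
  have := h (a :: l) rfl (List.isChain_cons.2 ⟨fun y hy => by
    rw [hl] at hy; obtain rfl : b = y := by simpa using hy
    exact hab, hc⟩)
  simpa using this

theorem chainsTo_of_terminal (h : ∀ b, ¬ R a b) :
    chainsTo R P a = {l | l = [a] ∧ P a} := by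
  ext l
  constructor
  · rintro ⟨hl, hc, c, hlast, hP⟩
    match l, hl with
    | [y], hl =>
      obtain rfl : y = a := by simpa using hl
      obtain rfl : y = c := by simpa using hlast
      exact ⟨rfl, hP⟩
    | y :: z :: l, hl =>
      obtain rfl : y = a := by simpa using hl
      exact absurd (List.isChain_cons_cons.1 hc).1 (h z)
  · rintro ⟨rfl, hP⟩
    exact ⟨rfl, by simp, a, rfl, hP⟩

theorem HasCount.of_terminal [Decidable (P a)] (h : ∀ b, ¬ R a b) :
    HasCount R P a (if P a then 1 else 0 : M) where
  bounded := by
    refine ⟨1, fun l hl hc => ?_⟩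
    match l, hl with
    | [y], hl => simp
    | y :: z :: l, hl =>
      obtain rfl : y = a := by simpa using hl
      exact absurd (List.isChain_cons_cons.1 hc).1 (h z)
  finite := by
    rw [chainsTo_of_terminal h]
    exact (Set.finite_singleton [a]).subset fun l hl => hl.1
  card := by
    rw [chainsTo_of_terminal h]
    split_ifs with hP <;> simp [hP]

theorem chainsTo_eq_biUnion (hP : ¬ P a) :
    chainsTo R P a = ⋃ b ∈ {b | R a b}, List.cons a '' chainsTo R P b := by
  ext l
  simp only [Set.mem_iUnion, Set.mem_image, Set.mem_ofPred_eq]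
  constructor
  · rintro ⟨hl, hc, c, hlast, hPc⟩
    match l, hl with
    | [y], hl =>
      obtain rfl : y = a := by simpa using hl
      obtain rfl : y = c := by simpa using hlast
      exact absurd hPc hP
    | y :: z :: l, hl =>
      obtain rfl : y = a := by simpa using hl
      obtain ⟨h1, h2⟩ := List.isChain_cons_cons.1 hc
      exact ⟨z, h1, z :: l, ⟨rfl, h2, c, by simpa using hlast, hPc⟩, rfl⟩
  · rintro ⟨b, hab, l, ⟨hl, hc, c, hlast, hPc⟩, rfl⟩
    refine ⟨rfl, List.isChain_cons.2 ⟨fun y hy => ?_, hc⟩, c, ?_, hPc⟩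
    · rw [hl] at hy
      obtain rfl : b = y := by simpa using hy
      exact hab
    · rw [List.getLast?_cons, hlast]; rfl

/-- Chains through different successors differ in their second entry, so their numbers add up. The
sum is over successors, not instructions, because paths are sequences of configurations. -/
theorem HasCount.of_step (hP : ¬ P a) (S : Finset α) (hS : ∀ b, R a b ↔ b ∈ S) {v : α → M}
    (h : ∀ b ∈ S, HasCount R P b (v b)) : HasCount R P a (∑ b ∈ S, v b) := by
  classical
  have key : chainsTo R P a = ⋃ b ∈ (S : Set α), List.cons a '' chainsTo R P b := by
    rw [chainsTo_eq_biUnion hP]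
    simp only [Set.mem_ofPred_eq, hS, Finset.mem_coe]
  have hfin : ∀ b ∈ (S : Set α), (List.cons a '' chainsTo R P b).Finite :=
    fun b hb => (h b hb).finite.image _
  refine ⟨?_, ?_, ?_⟩
  · choose! t ht using fun b hb => (h b hb).bounded
    refine ⟨S.sup t + 1, fun l hl hc => ?_⟩
    match l, hl with
    | [y], hl => simp
    | y :: z :: l, hl =>
      obtain rfl : y = a := by simpa using hl
      obtain ⟨h1, h2⟩ := List.isChain_cons_cons.1 hc
      have hz := (hS z).1 h1
      have := ht z hz (z :: l) rfl h2
      have := Finset.le_sup (f := t) hz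
      simp only [List.length_cons] at *
      omega
  · rw [key]
    exact S.finite_toSet.biUnion hfin
  · have : (chainsTo R P a).ncard = ∑ b ∈ S, (chainsTo R P b).ncard := by
      rw [key, ← finsum_mem_coe_finset, Set.Finite.ncard_biUnion S.finite_toSet hfin]
      · refine finsum_mem_congr rfl fun b _ => ?_
        exact Set.ncard_image_of_injective _ (List.cons_injective)
      · intro b _ b' _ hne
        refine Set.disjoint_left.2 ?_
        rintro _ ⟨l, hl, rfl⟩ ⟨l', hl', he⟩
        obtain rfl : l' = l := List.cons_injective he
        exact hne (Option.some.inj (hl.1.symm.trans hl'.1))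
    rw [this, Nat.cast_sum]
    exact Finset.sum_congr rfl fun b hb => (h b hb).card

theorem HasCount.of_range (hP : ¬ P a) {β : Type*} [Fintype β] {g : β → α}
    (hg : Function.Injective g) (hS : ∀ c, R a c ↔ ∃ i, c = g i) {v : β → M}
    (h : ∀ i, HasCount R P (g i) (v i)) : HasCount R P a (∑ i, v i) := by
  classical
  simpa [hg.extend_apply] using HasCount.of_step hP (Finset.univ.map ⟨g, hg⟩)
    (by simpa [eq_comm] using hS) (v := Function.extend g v 0)
    (by simpa [hg.extend_apply] using h)

theorem HasCount.of_unique_step (hP : ¬ P a) (hb : ∀ c, R a c ↔ c = b) {v : M}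
    (h : HasCount R P b v) : HasCount R P a v := by
  simpa using HasCount.of_step hP {b} (by simpa using hb) (v := fun _ => v) (by simpa using h)

theorem ChainsBounded.hasCount (hR : ∀ c, {b | R c b}.Finite) (hterm : ∀ c b, P c → ¬ R c b)
    {t : ℕ} (h : ChainsBounded R a t) : HasCount R P a (chainsTo R P a).ncard := by
  classical
  induction t generalizing a with
  | zero => exact absurd h.pos (lt_irrefl 0)
  | succ t ih =>
    by_cases hP : P a
    · have := HasCount.of_terminal (M := ℕ) (P := P) fun b => hterm a b hP
      exact ⟨this.bounded, this.finite, rfl⟩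
    · have := HasCount.of_step hP (hR a).toFinset (by simp)
        (v := fun b => (chainsTo R P b).ncard)
        fun b hb => ih (h.of_step (by simpa using hb))
      exact ⟨this.bounded, this.finite, rfl⟩

end Chains

/-! ### The power machine -/

instance : Finite Move :=
  Finite.of_injective (fun | Move.left => (0 : Fin 3) | Move.stay => 1 | Move.right => 2) <| by
    rintro (_ | _ | _) (_ | _ | _) h <;> simp_all

theorem inputSymbol_eq_leftEnd_iff (x : List Bool) (i : ℕ) :
    inputSymbol x i = InSym.leftEnd ↔ i = 0 := by
  cases i with
  | zero => simp [inputSymbol]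
  | succ i => simp only [inputSymbol]; split <;> simp

namespace NTM

/-- The instruction that changes the state to `q`, moves the input head by `mv`, and leaves the work
tapes, on which `g` is scanned, unchanged. -/
def keep {Q Γ ι : Type} (q : Q) (mv : Move) (g : ι → Γ) : Q × Move × (ι → Γ × Move) :=
  (q, mv, fun j => (g j, Move.stay))

/-- The configuration `C` with state and input head position replaced. -/
def Cfg.goto {T : NTM} (C : T.Cfg) (q : T.Q) (i : ℕ) : T.Cfg :=
  { C with state := q, inPos := i }

theorem exec_keep (T : NTM) (x : List Bool) (C : T.Cfg) (q : T.Q) (mv : Move) :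
    T.exec x C (keep q mv fun j => C.tape j (C.head j)) =
      C.goto q (mv.inShift x.length C.inPos) := by
  simp [exec, keep, Cfg.goto, Move.shift]

theorem finite_setOf_step (T : NTM) (x : List Bool) (c : T.Cfg) : {d | T.Step x c d}.Finite := by
  have := T.finQ
  have := T.finΓ
  have := T.finι
  refine (Set.finite_range (T.exec x c)).subset ?_
  rintro d ⟨-, -, a, -, rfl⟩
  exact ⟨a, rfl⟩

/-- States of the machine `T.pow n`. -/
inductive PowState (Q : Type) (n : ℕ) : Type
  | start
  | run (k r : Fin (n + 1)) (q : Q)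
  | rewind (k : Fin (n + 1)) (i : Fin n)
  | kill (i : Fin (n + 1))
  | acc
  | rej

instance {Q : Type} [Finite Q] {n : ℕ} : Finite (PowState Q n) :=
  Finite.of_injective
    (β := (Fin (n + 1) × Fin (n + 1) × Q) ⊕ (Fin (n + 1) × Fin n) ⊕ Fin (n + 1) ⊕ Fin 3)
    (fun
      | .start => .inr (.inr (.inr 0))
      | .run k r q => .inl (k, r, q)
      | .rewind k i => .inr (.inl (k, i))
      | .kill i => .inr (.inr (.inl i))
      | .acc => .inr (.inr (.inr 1))
      | .rej => .inr (.inr (.inr 2))) <| by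
    intro a b h
    cases a <;> cases b <;> simp_all

/-- The states that can follow the start state. -/
def PowState.branch {Q : Type} {n : ℕ} (q : Q) : Option (Fin (n + 1)) → PowState Q n
  | none => .rej
  | some k => .run k (Fin.last n) q

/-- The state in which branch `k` ends when all runs of `T` have accepted. -/
def PowState.final (Q : Type) {n : ℕ} (k : Fin (n + 1)) : PowState Q n :=
  if k = 0 then .acc else .rej

/-- An instruction of `T`, executed on copy `r` of its work tapes. -/
def liftInstr {Q Γ ι : Type} {n : ℕ} (k r : Fin (n + 1)) (g : Fin (n + 1) × ι → Γ)
    (a : Q × Move × (ι → Γ × Move)) :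
    PowState Q n × Move × (Fin (n + 1) × ι → Γ × Move) :=
  (.run k r a.1, a.2.1, fun j => if j.1 = r then a.2.2 j.2 else (g j, Move.stay))

open Classical in
/-- The instructions of `T.pow n`. -/
noncomputable def powTr (T : NTM) (n : ℕ) :
    PowState T.Q n → InSym → (Fin (n + 1) × T.ι → T.Γ) →
    Set (PowState T.Q n × Move × (Fin (n + 1) × T.ι → T.Γ × Move))
  | .start, _, g => Set.range fun b => keep (PowState.branch T.start b) .stay g
  | .run k r q, a, g =>
    if h : r = 0 then {keep (.final T.Q k) .stay g}
    else if q = T.acc then {keep (.rewind k (r.pred h)) .stay g}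
    else if q = T.rej then Set.range fun i => keep (.kill i) .stay g
    else liftInstr k r g '' T.tr q a fun i => g (r, i)
  | .rewind k i, .leftEnd, g => {keep (.run k i.castSucc T.start) .stay g}
  | .rewind k i, _, g => {keep (.rewind k i) .left g}
  | .kill _, _, g => {keep .rej .stay g}
  | .acc, _, _ => ∅
  | .rej, _, _ => ∅

/-- The machine that either rejects, or guesses `k ≤ n` and runs `T` on `n` separate copies of its
work tapes, one run after the other. If all these runs accept, it accepts or rejects according to
whether `k = 0` or not. As soon as a run rejects, it branches into `n + 1` rejecting paths. -/
noncomputable abbrev pow (T : NTM) (n : ℕ) : NTM where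
  Q := PowState T.Q n
  finQ := have := T.finQ; inferInstance
  Γ := T.Γ
  finΓ := T.finΓ
  blank := T.blank
  ι := Fin (n + 1) × T.ι
  finι := have := T.finι; inferInstance
  start := .start
  acc := .acc
  rej := .rej
  acc_ne_rej := by simp
  tr := T.powTr n
  tr_nonempty := by
    rintro (_ | ⟨k, r, q⟩ | ⟨k, i⟩ | _ | _ | _) a g h1 h2
    · exact Set.range_nonempty _
    · simp only [powTr]
      split_ifs with h h' h''
      · exact Set.singleton_nonempty _
      · exact Set.singleton_nonempty _
      · exact Set.range_nonempty _
      · exact (T.tr_nonempty _ _ _ h' h'').image _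
    · cases a <;> exact Set.singleton_nonempty _
    · exact Set.singleton_nonempty _
    · exact absurd rfl h1
    · exact absurd rfl h2

/-! ### Single steps of the power machine -/

section Pow

variable {T : NTM} {n : ℕ} {x : List Bool}

theorem pow_step_iff {C D : (T.pow n).Cfg} {s : PowState T.Q n} (h : C.state = s)
    (ha : s ≠ .acc) (hr : s ≠ .rej) :
    (T.pow n).Step x C D ↔ ∃ a ∈ T.powTr n s (inputSymbol x C.inPos) fun j => C.tape j (C.head j),
      D = (T.pow n).exec x C a := by
  subst h
  exact ⟨fun h => h.2.2, fun h => ⟨ha, hr, h⟩⟩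

theorem pow_step_iff_of_range {C D : (T.pow n).Cfg} {s : PowState T.Q n} (h : C.state = s)
    (ha : s ≠ .acc) (hr : s ≠ .rej) {β : Type*} {f : β → PowState T.Q n} {mv : Move}
    (htr : ∀ g, T.powTr n s (inputSymbol x C.inPos) g = Set.range fun b => keep (f b) mv g) :
    (T.pow n).Step x C D ↔ ∃ b, D = C.goto (f b) (mv.inShift x.length C.inPos) := by
  rw [pow_step_iff h ha hr, htr, Set.exists_range_iff]
  exact exists_congr fun b => by rw [← exec_keep (T.pow n)]

theorem pow_step_iff_of_singleton {C D : (T.pow n).Cfg} {s : PowState T.Q n} (h : C.state = s)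
    (ha : s ≠ .acc) (hr : s ≠ .rej) {q : PowState T.Q n} {mv : Move}
    (htr : ∀ g, T.powTr n s (inputSymbol x C.inPos) g = {keep q mv g}) :
    (T.pow n).Step x C D ↔ D = C.goto q (mv.inShift x.length C.inPos) := by
  rw [pow_step_iff_of_range h ha hr (f := fun _ : Unit => q) (mv := mv)]
  · simp
  · simpa using htr

theorem pow_step_start {C D : (T.pow n).Cfg} (h : C.state = PowState.start) :
    (T.pow n).Step x C D ↔ ∃ b, D = C.goto (PowState.branch T.start b) C.inPos :=
  pow_step_iff_of_range h (by simp) (by simp) (mv := .stay) fun g => rfl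

theorem pow_step_run_zero {C D : (T.pow n).Cfg} {k q} (h : C.state = PowState.run k 0 q) :
    (T.pow n).Step x C D ↔ D = C.goto (PowState.final T.Q k) C.inPos :=
  pow_step_iff_of_singleton h (by simp) (by simp) (mv := .stay) fun g => by simp [powTr]

theorem pow_step_run_acc {C D : (T.pow n).Cfg} {k} {i : Fin n}
    (h : C.state = PowState.run k i.succ T.acc) :
    (T.pow n).Step x C D ↔ D = C.goto (PowState.rewind k i) C.inPos :=
  pow_step_iff_of_singleton h (by simp) (by simp) (mv := .stay) fun g => by simp [powTr]

theorem pow_step_run_rej {C D : (T.pow n).Cfg} {k} {i : Fin n}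
    (h : C.state = PowState.run k i.succ T.rej) :
    (T.pow n).Step x C D ↔ ∃ i, D = C.goto (PowState.kill i) C.inPos :=
  pow_step_iff_of_range h (by simp) (by simp) (mv := .stay) fun g => by
    simp [powTr, T.acc_ne_rej.symm]

theorem pow_step_rewind_zero {C D : (T.pow n).Cfg} {k i}
    (h : C.state = PowState.rewind k i) (h0 : C.inPos = 0) :
    (T.pow n).Step x C D ↔ D = C.goto (PowState.run k i.castSucc T.start) C.inPos :=
  pow_step_iff_of_singleton h (by simp) (by simp) (mv := .stay) fun g => by
    rw [(inputSymbol_eq_leftEnd_iff _ _).2 h0]; rfl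

theorem pow_step_rewind_succ {C D : (T.pow n).Cfg} {k i}
    (h : C.state = PowState.rewind k i) (h0 : C.inPos ≠ 0) :
    (T.pow n).Step x C D ↔ D = C.goto (PowState.rewind k i) (C.inPos - 1) :=
  pow_step_iff_of_singleton h (by simp) (by simp) (mv := .left) fun g => by
    have := (inputSymbol_eq_leftEnd_iff x C.inPos).not.2 h0
    generalize inputSymbol x C.inPos = a at this
    cases a
    · exact absurd rfl this
    all_goals rfl

theorem pow_step_kill {C D : (T.pow n).Cfg} {i} (h : C.state = PowState.kill i) :
    (T.pow n).Step x C D ↔ D = C.goto PowState.rej C.inPos :=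
  pow_step_iff_of_singleton h (by simp) (by simp) (mv := .stay) fun g => rfl

theorem pow_not_step_acc {C D : (T.pow n).Cfg} (h : C.state = PowState.acc) :
    ¬ (T.pow n).Step x C D := fun hs => hs.1 h

theorem pow_not_step_rej {C D : (T.pow n).Cfg} (h : C.state = PowState.rej) :
    ¬ (T.pow n).Step x C D := fun hs => hs.2.1 h

/-- The configuration of `T.pow n` in which copy `r` of `T` is in configuration `c`, and the other
copies of the work tapes are as in `C`. -/
def liftCfg (k r : Fin (n + 1)) (C : (T.pow n).Cfg) (c : T.Cfg) : (T.pow n).Cfg where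
  state := PowState.run k r c.state
  inPos := c.inPos
  tape := fun j => if j.1 = r then c.tape j.2 else C.tape j
  head := fun j => if j.1 = r then c.head j.2 else C.head j

/-- All of `c` can be read off from the state, the input head and copy `r`. Hence distinct
successors in `T` stay distinct, and the simulation preserves branching. -/
theorem liftCfg_injective (k r : Fin (n + 1)) (C : (T.pow n).Cfg) :
    Function.Injective (liftCfg k r C) := by
  intro c d h
  have h1 : PowState.run k r c.state = PowState.run k r d.state := congrArg Cfg.state h
  have h2 := congrArg Cfg.inPos h
  have h3 := congrArg Cfg.tape h
  have h4 := congrArg Cfg.head h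
  ext1
  · simpa using h1
  · exact h2
  · funext i
    simpa [liftCfg] using congrFun h3 (r, i)
  · funext i
    simpa [liftCfg] using congrFun h4 (r, i)

theorem pow_exec_liftInstr (k r : Fin (n + 1)) (C : (T.pow n).Cfg) (c : T.Cfg)
    (a : T.Q × Move × (T.ι → T.Γ × Move)) :
    (T.pow n).exec x (liftCfg k r C c)
      (liftInstr k r (fun j => (liftCfg k r C c).tape j ((liftCfg k r C c).head j)) a) =
        liftCfg k r C (T.exec x c a) := by
  ext1
  · rfl
  · rfl
  · funext j
    by_cases hj : j.1 = r
    · simp [exec, liftInstr, liftCfg, hj]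
    · simp [exec, liftInstr, liftCfg, hj]
  · funext j
    by_cases hj : j.1 = r
    · simp [exec, liftInstr, liftCfg, hj]
    · simp [exec, liftInstr, liftCfg, hj, Move.shift]

theorem pow_step_liftCfg {C D : (T.pow n).Cfg} {c : T.Cfg} {k r : Fin (n + 1)} (h0 : r ≠ 0)
    (ha : c.state ≠ T.acc) (hr : c.state ≠ T.rej) :
    (T.pow n).Step x (liftCfg k r C c) D ↔ ∃ d, T.Step x c d ∧ D = liftCfg k r C d := by
  have h : (liftCfg k r C c).state = PowState.run k r c.state := rfl
  have htr (a : InSym) (g : Fin (n + 1) × T.ι → T.Γ) : T.powTr n (PowState.run k r c.state) a g =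
      liftInstr k r g '' T.tr c.state a fun i => g (r, i) := by
    simp [powTr, h0, ha, hr]
  rw [pow_step_iff h (by simp) (by simp), htr, Set.exists_mem_image]
  have e : (fun i => (liftCfg k r C c).tape (r, i) ((liftCfg k r C c).head (r, i))) =
      fun i => c.tape i (c.head i) := by
    simp [liftCfg]
  constructor
  · rintro ⟨a, haT, rfl⟩
    exact ⟨_, ⟨ha, hr, a, e ▸ haT, rfl⟩, pow_exec_liftInstr k r C c a⟩
  · rintro ⟨_, ⟨-, -, a, haT, rfl⟩, rfl⟩
    exact ⟨a, e.symm ▸ haT, (pow_exec_liftInstr k r C c a).symm⟩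

end Pow

/-! ### Counting paths of the power machine modulo n + 1 -/

theorem numAccept_eq_ncard_chainsTo (T : NTM) (x : List Bool) :
    T.numAccept x = (chainsTo (T.Step x) (fun d => d.state = T.acc) T.init).ncard := by
  simp only [numAccept, pathsTo, IsPath, chainsTo, and_assoc]

section Counting

variable {T : NTM} {n : ℕ} {x : List Bool} {F : PowState T.Q n}

open Classical in
theorem pow_hasCount_rej {M : Type*} [Semiring M] {C : (T.pow n).Cfg}
    (h : C.state = PowState.rej) :
    HasCount ((T.pow n).Step x) (fun D => D.state = F) C (if .rej = F then 1 else 0 : M) := by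
  simpa only [h] using
    HasCount.of_terminal (P := fun D : (T.pow n).Cfg => D.state = F)
      fun D => pow_not_step_rej (x := x) (D := D) h

open Classical in
theorem pow_hasCount_acc {M : Type*} [Semiring M] {C : (T.pow n).Cfg}
    (h : C.state = PowState.acc) :
    HasCount ((T.pow n).Step x) (fun D => D.state = F) C (if .acc = F then 1 else 0 : M) := by
  simpa only [h] using
    HasCount.of_terminal (P := fun D : (T.pow n).Cfg => D.state = F)
      fun D => pow_not_step_acc (x := x) (D := D) h

theorem ne_of_state {C : (T.pow n).Cfg} {s : PowState T.Q n} (hF : F = .acc ∨ F = .rej)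
    (h : C.state = s) (ha : s ≠ .acc) (hr : s ≠ .rej) : ¬ C.state = F := by
  rw [h]
  rcases hF with rfl | rfl <;> assumption

/-- The `kill` states are distinct, so the n + 1 paths through them are distinct although all end in
`rej`; their number vanishes in `ZMod (n + 1)`. -/
theorem pow_hasCount_run_rej (hF : F = .acc ∨ F = .rej) {C : (T.pow n).Cfg} {k} {i : Fin n}
    (h : C.state = PowState.run k i.succ T.rej) :
    HasCount ((T.pow n).Step x) (fun D => D.state = F) C (0 : ZMod (n + 1)) := by
  classical
  have := HasCount.of_range (R := (T.pow n).Step x) (ne_of_state hF h (by simp) (by simp))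
    (g := fun i => C.goto (PowState.kill i) C.inPos)
    (fun i j hij => PowState.kill.inj (congrArg Cfg.state hij))
    (fun D => pow_step_run_rej h) (v := fun _ => (if .rej = F then 1 else 0 : ZMod (n + 1)))
    fun i => HasCount.of_unique_step (R := (T.pow n).Step x)
      (ne_of_state hF (s := .kill i) rfl
      (by simp) (by simp)) (fun D => pow_step_kill rfl) (pow_hasCount_rej rfl)
  have h0 : ((n : ZMod (n + 1)) + 1) = 0 := by exact_mod_cast ZMod.natCast_self (n + 1)
  simpa [h0] using this

/-- Rewinding is deterministic and ends at the left end marker, so it does not change the count. -/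
theorem pow_hasCount_rewind {M : Type*} [Semiring M] (hF : F = .acc ∨ F = .rej)
    {C : (T.pow n).Cfg} {k} {i : Fin n} (h : C.state = PowState.rewind k i) {w : M}
    (hw : HasCount ((T.pow n).Step x) (fun D => D.state = F)
      (C.goto (PowState.run k i.castSucc T.start) 0) w) :
    HasCount ((T.pow n).Step x) (fun D => D.state = F) C w := by
  induction hp : C.inPos generalizing C with
  | zero =>
    refine HasCount.of_unique_step (R := (T.pow n).Step x)
      (ne_of_state hF h (by simp) (by simp))
      (fun D => pow_step_rewind_zero h hp) ?_
    rwa [hp]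
  | succ m ih =>
    refine HasCount.of_unique_step (R := (T.pow n).Step x)
      (ne_of_state hF h (by simp) (by simp))
      (fun D => pow_step_rewind_succ h (by omega)) ?_
    exact ih rfl hw (by simp [Cfg.goto, hp])

/-- Every accepting path of `T` from `c` is continued with the same weight `w`, whatever it leaves
on copy `i.succ`: `hw` covers all configurations that agree with `C` off that copy. Rejecting paths
have weight 0. -/
theorem pow_hasCount_liftCfg (hF : F = .acc ∨ F = .rej) {C : (T.pow n).Cfg} {k} {i : Fin n}
    {w : ZMod (n + 1)}
    (hw : ∀ D : (T.pow n).Cfg, D.state = PowState.run k i.castSucc T.start → D.inPos = 0 →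
      (∀ j : Fin (n + 1) × T.ι, j.1 ≠ i.succ → D.tape j = C.tape j ∧ D.head j = C.head j) →
      HasCount ((T.pow n).Step x) (fun D => D.state = F) D w)
    {c : T.Cfg} {t : ℕ} (h : ChainsBounded (T.Step x) c t) :
    HasCount ((T.pow n).Step x) (fun D => D.state = F) (liftCfg k i.succ C c)
      ((chainsTo (T.Step x) (fun d => d.state = T.acc) c).ncard * w) := by
  classical
  induction t generalizing c with
  | zero => exact absurd h.pos (lt_irrefl 0)
  | succ t ih =>
    have hC : (liftCfg k i.succ C c).state = PowState.run k i.succ c.state := rfl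
    have hP := ne_of_state hF hC (by simp) (by simp)
    by_cases ha : c.state = T.acc
    · have h1 := HasCount.of_terminal (R := T.Step x) (M := ZMod (n + 1))
        (P := fun d => d.state = T.acc) (a := c) fun d hd => hd.1 ha
      rw [h1.card, if_pos ha, one_mul]
      rw [ha] at hC
      refine HasCount.of_unique_step (R := (T.pow n).Step x) hP (fun D => pow_step_run_acc hC) ?_
      refine pow_hasCount_rewind hF rfl (hw _ rfl rfl fun j hj => ?_)
      simp [Cfg.goto, liftCfg, hj]
    by_cases hr : c.state = T.rej
    · have h1 := HasCount.of_terminal (R := T.Step x) (M := ZMod (n + 1))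
        (P := fun d => d.state = T.acc) (a := c) fun d hd => hd.2.1 hr
      rw [h1.card, if_neg ha, zero_mul]
      rw [hr] at hC
      exact pow_hasCount_run_rej hF hC
    have hfin := T.finite_setOf_step x c
    have h1 := HasCount.of_step (R := T.Step x) (M := ZMod (n + 1))
      (P := fun d => d.state = T.acc) (a := c) ha hfin.toFinset (by simp)
      (v := fun d => ((chainsTo (T.Step x) (fun d => d.state = T.acc) d).ncard : ZMod (n + 1)))
      fun d hd => by
        have := (h.of_step (by simpa using hd)).hasCount (T.finite_setOf_step x)
          (P := fun d => d.state = T.acc) fun c b hc hb => hb.1 hc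
        exact ⟨this.bounded, this.finite, rfl⟩
    rw [h1.card, Finset.sum_mul]
    have hinj := liftCfg_injective k i.succ C
    have := HasCount.of_step (R := (T.pow n).Step x) hP
      (hfin.toFinset.map ⟨liftCfg k i.succ C, hinj⟩)
      (fun D => by
        rw [pow_step_liftCfg (k := k) (C := C) i.succ_ne_zero ha hr]
        simp [eq_comm])
      -- Weights are needed on all configurations of `T.pow n`; off the image of `liftCfg` the
      -- default 0 is never used.
      (v := Function.extend (liftCfg k i.succ C) (fun d =>
        ((chainsTo (T.Step x) (fun d => d.state = T.acc) d).ncard : ZMod (n + 1)) * w) 0)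
      (by
        simp only [Finset.mem_map, Set.Finite.mem_toFinset, Set.mem_ofPred_eq,
          Function.Embedding.coeFn_mk, forall_exists_index, and_imp, forall_apply_eq_imp_iff₂,
          hinj.extend_apply]
        exact fun d hd => ih (h.of_step hd))
    simpa [hinj.extend_apply] using this

-- Each run contributes one factor N. Since copies are used in decreasing order, blankness of the
-- copies up to `r` is what the remaining runs need.
open Classical in
theorem pow_hasCount_run (hF : F = .acc ∨ F = .rej) (hT : ∃ t, ChainsBounded (T.Step x) T.init t)
    (k r : Fin (n + 1)) (C : (T.pow n).Cfg) (hC : C.state = PowState.run k r T.start)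
    (h0 : C.inPos = 0)
    (hblank : ∀ j : Fin (n + 1) × T.ι, j.1 ≤ r → (C.tape j = fun _ => T.blank) ∧ C.head j = 0) :
    HasCount ((T.pow n).Step x) (fun D => D.state = F) C
      ((T.numAccept x : ZMod (n + 1)) ^ (r : ℕ) *
        if PowState.final T.Q k = F then 1 else 0) := by
  induction r using Fin.induction generalizing C with
  | zero =>
    refine HasCount.of_unique_step (R := (T.pow n).Step x)
      (ne_of_state hF hC (by simp) (by simp))
      (fun D => pow_step_run_zero hC) ?_
    by_cases hk : k = 0
    · simpa [PowState.final, hk] using pow_hasCount_acc rfl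
    · simpa [PowState.final, hk] using pow_hasCount_rej rfl
  | succ i ih =>
    obtain ⟨t, ht⟩ := hT
    have hlift : liftCfg k i.succ C T.init = C := by
      ext1
      · exact hC.symm
      · exact h0.symm
      · funext j
        by_cases hj : j.1 = i.succ
        · simp [liftCfg, init, hj, (hblank j hj.le).1]
        · simp [liftCfg, hj]
      · funext j
        by_cases hj : j.1 = i.succ
        · simp [liftCfg, init, hj, (hblank j hj.le).2]
        · simp [liftCfg, hj]
    have := pow_hasCount_liftCfg hF (C := C) (k := k) (i := i) (fun D h1 h2 h3 => ih D h1 h2 ?_) ht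
    · rw [hlift, ← mul_assoc, ← numAccept_eq_ncard_chainsTo, ← pow_succ'] at this
      exact this
    · intro j hj
      have hlt : j.1 < i.succ := hj.trans_lt i.castSucc_lt_succ
      rw [(h3 j hlt.ne).1, (h3 j hlt.ne).2]
      exact hblank j hlt.le

open Classical in
theorem pow_hasCount_init (hF : F = .acc ∨ F = .rej)
    (hT : ∃ t, ChainsBounded (T.Step x) T.init t) :
    HasCount ((T.pow n).Step x) (fun D => D.state = F) (T.pow n).init
      ((if .rej = F then 1 else 0) + ∑ k : Fin (n + 1), (T.numAccept x : ZMod (n + 1)) ^ n *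
        if PowState.final T.Q k = F then 1 else 0) := by
  have h : (T.pow n).init.state = PowState.start := rfl
  have := HasCount.of_range (R := (T.pow n).Step x) (ne_of_state hF h (by simp) (by simp))
    (g := fun b => (T.pow n).init.goto (PowState.branch T.start b) 0)
    (fun b c hbc => by
      have := congrArg Cfg.state hbc
      cases b <;> cases c <;> simp_all [Cfg.goto, PowState.branch])
    (fun D => pow_step_start h)
    (v := fun b => b.elim (if .rej = F then 1 else 0 : ZMod (n + 1)) fun k =>
      (T.numAccept x : ZMod (n + 1)) ^ n * if PowState.final T.Q k = F then 1 else 0)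
    (by
      rintro (_ | k)
      · exact pow_hasCount_rej rfl
      · exact pow_hasCount_run hF hT k (Fin.last n) _ rfl rfl fun j _ => ⟨rfl, rfl⟩)
  simpa only [Fintype.sum_option, Option.elim] using this

end Counting

/-! ### Memory used by the power machine -/

section Memory

variable {T : NTM} {n : ℕ} {x : List Bool}

/-- Copy `j` of the work tapes in the configuration `C` of `T.pow n` is untouched, and `c` is the
initial configuration of `T`. -/
def Untouched (j : Fin (n + 1)) (C : (T.pow n).Cfg) (c : T.Cfg) : Prop :=
  c = T.init ∧ ∀ i, C.tape (j, i) = fun _ => T.blank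

/-- The configuration `C` of `T.pow n` corresponds to the configuration `c` of `T` as far as the
run of `T` on copy `j` of the work tapes is concerned. -/
structure Matches (j : Fin (n + 1)) (C : (T.pow n).Cfg) (c : T.Cfg) : Prop where
  head : ∀ i, C.head (j, i) = c.head i
  start : C.state = PowState.start → C.inPos = 0 ∧ Untouched j C c
  run_of_lt : ∀ k r q, C.state = PowState.run k r q → j < r → Untouched j C c
  run_of_eq : ∀ k q, C.state = PowState.run k j q →
    c.state = q ∧ c.inPos = C.inPos ∧ ∀ i, C.tape (j, i) = c.tape i
  rewind : ∀ k i, C.state = PowState.rewind k i → j ≤ i.castSucc → Untouched j C c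

theorem Matches.init (j : Fin (n + 1)) : Matches j (T.pow n).init T.init where
  head _ := rfl
  start _ := ⟨rfl, rfl, fun _ => rfl⟩
  run_of_lt _ _ _ h := by simp [NTM.init] at h
  run_of_eq _ _ h := by simp [NTM.init] at h
  rewind _ _ h := by simp [NTM.init] at h

theorem Matches.goto_run {j : Fin (n + 1)} {C : (T.pow n).Cfg} {c : T.Cfg} (h : Matches j C c)
    {k r : Fin (n + 1)} (h0 : C.inPos = 0) (hj : j ≤ r → Untouched j C c) :
    Matches j (C.goto (PowState.run k r T.start) C.inPos) c where
  head := h.head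
  start h := by simp [Cfg.goto] at h
  run_of_lt k' r' q' h hlt := by
    obtain ⟨rfl, rfl, rfl⟩ : k = k' ∧ r = r' ∧ T.start = q' := by simpa [Cfg.goto] using h
    exact hj hlt.le
  run_of_eq k' q' h := by
    obtain ⟨rfl, rfl, rfl⟩ : k = k' ∧ r = j ∧ T.start = q' := by simpa [Cfg.goto] using h
    obtain ⟨rfl, h2⟩ := hj le_rfl
    exact ⟨rfl, h0.symm, h2⟩
  rewind _ _ h := by simp [Cfg.goto] at h

theorem Matches.goto_rewind {j : Fin (n + 1)} {C : (T.pow n).Cfg} {c : T.Cfg} (h : Matches j C c)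
    {k : Fin (n + 1)} {i : Fin n} (hj : j ≤ i.castSucc → Untouched j C c) (m : ℕ) :
    Matches j (C.goto (PowState.rewind k i) m) c where
  head := h.head
  start h := by simp [Cfg.goto] at h
  run_of_lt _ _ _ h := by simp [Cfg.goto] at h
  run_of_eq _ _ h := by simp [Cfg.goto] at h
  rewind k' i' h hle := by
    obtain ⟨rfl, rfl⟩ : k = k' ∧ i = i' := by simpa [Cfg.goto] using h
    exact hj hle

theorem Matches.goto_other {j : Fin (n + 1)} {C : (T.pow n).Cfg} {c : T.Cfg} (h : Matches j C c)
    {s : PowState T.Q n} (h1 : s ≠ .start) (h2 : ∀ k r q, s ≠ .run k r q)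
    (h3 : ∀ k i, s ≠ .rewind k i) (m : ℕ) : Matches j (C.goto s m) c where
  head := h.head
  start h := absurd h h1
  run_of_lt _ _ _ h := absurd h (h2 _ _ _)
  run_of_eq _ _ h := absurd h (h2 _ _ _)
  rewind _ _ h := absurd h (h3 _ _)

theorem liftCfg_self {k r : Fin (n + 1)} {q : T.Q} {C : (T.pow n).Cfg}
    (h : C.state = PowState.run k r q) :
    liftCfg k r C ⟨q, C.inPos, fun i => C.tape (r, i), fun i => C.head (r, i)⟩ = C := by
  ext1
  · exact h.symm
  · rfl
  · funext ⟨j, i⟩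
    by_cases hj : j = r
    · subst hj; simp [liftCfg]
    · simp [liftCfg, hj]
  · funext ⟨j, i⟩
    by_cases hj : j = r
    · subst hj; simp [liftCfg]
    · simp [liftCfg, hj]

/-- Only a simulated instruction on copy `j` advances `c`; all other steps leave the heads of that
copy in place. The `Untouched` clauses ensure that the run on copy `j` starts from `T.init`; once it
is over, only the `head` clause still matters. -/
theorem Matches.step {j : Fin (n + 1)} {C D : (T.pow n).Cfg} {c : T.Cfg} (h : Matches j C c)
    (hs : (T.pow n).Step x C D) : Matches j D c ∨ ∃ d, T.Step x c d ∧ Matches j D d := by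
  rcases hC : C.state with _ | ⟨k, r, q⟩ | ⟨k, i⟩ | i | _ | _
  · left
    obtain ⟨_ | k, rfl⟩ := (pow_step_start hC).1 hs
    · exact h.goto_other (by simp [PowState.branch]) (by simp [PowState.branch])
        (by simp [PowState.branch]) _
    · exact h.goto_run (h.start hC).1 fun _ => (h.start hC).2
  · obtain rfl | ⟨i, rfl⟩ := r.eq_zero_or_eq_succ
    · left
      obtain rfl := (pow_step_run_zero hC).1 hs
      refine h.goto_other ?_ ?_ ?_ _ <;> intros <;> simp only [PowState.final] <;> split_ifs <;> simp
    by_cases ha : q = T.acc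
    · left
      subst ha
      obtain rfl := (pow_step_run_acc hC).1 hs
      exact h.goto_rewind (fun hj => h.run_of_lt _ _ _ hC (hj.trans_lt i.castSucc_lt_succ)) _
    by_cases hr : q = T.rej
    · left
      subst hr
      obtain ⟨l, rfl⟩ := (pow_step_run_rej hC).1 hs
      exact h.goto_other (by simp) (by simp) (by simp) _
    rw [← liftCfg_self hC, pow_step_liftCfg i.succ_ne_zero ha hr] at hs
    obtain ⟨d, hd, rfl⟩ := hs
    by_cases hj : j = i.succ
    · right
      subst hj
      obtain ⟨h1, h2, h3⟩ := h.run_of_eq _ _ hC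
      have hc : c = ⟨q, C.inPos, fun l => C.tape (i.succ, l), fun l => C.head (i.succ, l)⟩ := by
        ext1
        · exact h1
        · exact h2
        · exact funext fun l => (h3 l).symm
        · exact funext fun l => (h.head l).symm
      refine ⟨d, hc ▸ hd, ?_, ?_, ?_, ?_, ?_⟩
      · simp [liftCfg]
      · simp [liftCfg]
      · rintro k' r' q' he hlt
        obtain ⟨rfl, rfl, rfl⟩ : k = k' ∧ i.succ = r' ∧ d.state = q' := by simpa [liftCfg] using he
        exact absurd hlt (lt_irrefl _)
      · rintro k' q' he
        obtain ⟨rfl, rfl⟩ : k = k' ∧ d.state = q' := by simpa [liftCfg] using he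
        exact ⟨rfl, rfl, fun l => by simp [liftCfg]⟩
      · simp [liftCfg]
    · left
      refine ⟨?_, ?_, ?_, ?_, ?_⟩
      · simpa [liftCfg, hj] using h.head
      · simp [liftCfg]
      · rintro k' r' q' he hlt
        obtain ⟨rfl, rfl, rfl⟩ : k = k' ∧ i.succ = r' ∧ d.state = q' := by simpa [liftCfg] using he
        have := h.run_of_lt _ _ _ hC hlt
        exact ⟨this.1, by simpa [liftCfg, hj] using this.2⟩
      · rintro k' q' he
        obtain ⟨rfl, rfl, rfl⟩ : k = k' ∧ i.succ = j ∧ d.state = q' := by simpa [liftCfg] using he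
        exact absurd rfl hj
      · simp [liftCfg]
  · left
    by_cases h0 : C.inPos = 0
    · obtain rfl := (pow_step_rewind_zero hC h0).1 hs
      exact h.goto_run h0 (h.rewind _ _ hC)
    · obtain rfl := (pow_step_rewind_succ hC h0).1 hs
      exact h.goto_rewind (h.rewind _ _ hC) _
  · left
    obtain rfl := (pow_step_kill hC).1 hs
    exact h.goto_other (by simp) (by simp) (by simp) _
  · exact absurd hs (pow_not_step_acc hC)
  · exact absurd hs (pow_not_step_rej hC)

/-- Copy `j` hosts at most one run, so its head positions along a path are those along a single path
of `T`, with repetitions. -/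
theorem exists_isPath_of_pow_isPath (j : Fin (n + 1)) (l : List (T.pow n).Cfg)
    (hl : (T.pow n).IsPath x l) :
    ∃ L, T.IsPath x L ∧ (∃ C c, l.getLast? = some C ∧ L.getLast? = some c ∧ Matches j C c) ∧
      ∀ C ∈ l, ∃ c ∈ L, ∀ i, C.head (j, i) = c.head i := by
  induction l using List.reverseRecOn with
  | nil => simp [IsPath] at hl
  | append_singleton l D ih =>
    rcases List.eq_nil_or_concat' l with rfl | ⟨l', C', rfl⟩
    · obtain rfl : D = (T.pow n).init := by simpa [IsPath] using hl.1
      exact ⟨[T.init], ⟨rfl, by simp⟩, ⟨_, _, rfl, rfl, Matches.init j⟩, by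
        simpa using fun i => (Matches.init j).head i⟩
    · obtain ⟨hh, hc⟩ := hl
      obtain ⟨hc1, -, hc2⟩ := List.isChain_append.1 hc
      obtain ⟨L, hL, ⟨C, c, hC, hcL, hm⟩, hmem⟩ := ih ⟨by simpa using hh, hc1⟩
      have hstep : (T.pow n).Step x C D := hc2 C hC D rfl
      rcases hm.step hstep with hD | ⟨d, hd, hD⟩
      · refine ⟨L, hL, ⟨D, c, by simp, hcL, hD⟩, fun E hE => ?_⟩
        rcases List.mem_append.1 hE with hE | hE
        · exact hmem E hE
        · obtain rfl : E = D := by simpa using hE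
          exact ⟨c, List.mem_of_getLast? hcL, hD.head⟩
      · refine ⟨L ++ [d], ⟨?_, ?_⟩, ⟨D, d, by simp, by simp, hD⟩, fun E hE => ?_⟩
        · rw [List.head?_append, hL.1]; rfl
        · refine List.isChain_append.2 ⟨hL.2, by simp, fun y hy z hz => ?_⟩
          obtain rfl : c = y := by simpa [hcL] using hy
          obtain rfl : d = z := by simpa using hz
          exact hd
        · rcases List.mem_append.1 hE with hE | hE
          · obtain ⟨e, he, heq⟩ := hmem E hE
            exact ⟨e, List.mem_append_left _ he, heq⟩
          · obtain rfl : E = D := by simpa using hE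
            exact ⟨d, by simp, hD.head⟩

theorem finite_setOf_scanned (T : NTM) (l : List T.Cfg) :
    {z : T.ι × ℤ | ∃ c ∈ l, c.head z.1 = z.2}.Finite := by
  have := T.finι
  have : {z : T.ι × ℤ | ∃ c ∈ l, c.head z.1 = z.2} =
      ⋃ c ∈ {c | c ∈ l}, Set.range fun i => (i, c.head i) := by
    ext ⟨i, z⟩
    simp
  rw [this]
  exact (List.finite_toSet l).biUnion fun c _ => Set.finite_range _

/-- The factor is n + 1 rather than n because copy 0, on which nothing is run, still has its heads
resting on a cell. -/
theorem UsesMemory.pow {m : ℕ → ℕ} (h : T.UsesMemory m) (n : ℕ) :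
    (T.pow n).UsesMemory fun N => (n + 1) * m N := by
  intro x l hl
  choose L hL _ hmem using fun j : Fin (n + 1) => exists_isPath_of_pow_isPath j l hl
  have hsub : {z : (Fin (n + 1) × T.ι) × ℤ | ∃ c ∈ l, c.head z.1 = z.2} ⊆
      ⋃ j ∈ (Finset.univ : Finset (Fin (n + 1))), (fun z : T.ι × ℤ => ((j, z.1), z.2)) ''
        {z : T.ι × ℤ | ∃ c ∈ L j, c.head z.1 = z.2} := by
    rintro ⟨⟨j, i⟩, z⟩ ⟨C, hC, hz⟩
    obtain ⟨c, hc, he⟩ := hmem j C hC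
    simp only [Finset.mem_univ, Set.iUnion_true, Set.mem_iUnion]
    exact ⟨j, (i, c.head i), ⟨c, hc, rfl⟩, by simpa [he] using hz⟩
  refine (Set.ncard_le_ncard hsub ?_).trans ((Finset.set_ncard_biUnion_le _ _).trans ?_)
  · exact Finset.univ.finite_toSet.biUnion fun j _ => (finite_setOf_scanned T (L j)).image _
  · refine (Finset.sum_le_card_nsmul _ _ (m x.length) fun j _ => ?_).trans (by simp)
    exact (Set.ncard_image_le (finite_setOf_scanned T (L j))).trans (h x (L j) (hL j))

end Memory

/-! ### Path counts, Fermat's theorem and the conclusion -/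

theorem numReject_eq_ncard_chainsTo (T : NTM) (x : List Bool) :
    T.numReject x = (chainsTo (T.Step x) (fun d => d.state = T.rej) T.init).ncard := by
  simp only [numReject, pathsTo, IsPath, chainsTo, and_assoc]

theorem Halts.chainsBounded {T : NTM} (h : T.Halts) (x : List Bool) :
    ∃ t, ChainsBounded (T.Step x) T.init t :=
  (h x).imp fun _ ht l h1 h2 => ht l ⟨h1, h2⟩

theorem Halts.pow {T : NTM} (h : T.Halts) (n : ℕ) : (T.pow n).Halts := fun x =>
  (pow_hasCount_init (n := n) (Or.inl rfl) (h.chainsBounded x)).bounded.imp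
    fun _ ht l hl => ht l hl.1 hl.2

theorem cast_numAccept_pow {T : NTM} (h : T.Halts) (n : ℕ) (x : List Bool) :
    ((T.pow n).numAccept x : ZMod (n + 1)) = (T.numAccept x : ZMod (n + 1)) ^ n := by
  rw [numAccept_eq_ncard_chainsTo (T.pow n),
    (pow_hasCount_init (n := n) (F := .acc) (Or.inl rfl) (h.chainsBounded x)).card]
  have (k : Fin (n + 1)) : PowState.final T.Q k = .acc ↔ k = 0 := by
    simp [PowState.final]
  simp [this]

theorem cast_numReject_pow {T : NTM} (h : T.Halts) (n : ℕ) (x : List Bool) :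
    ((T.pow n).numReject x : ZMod (n + 1)) = 1 - (T.numAccept x : ZMod (n + 1)) ^ n := by
  rw [numReject_eq_ncard_chainsTo (T.pow n),
    (pow_hasCount_init (n := n) (F := .rej) (Or.inr rfl) (h.chainsBounded x)).card]
  have (k : Fin n) : PowState.final T.Q k.succ = .rej := by
    simp [PowState.final]
  have h0 : PowState.final T.Q (0 : Fin (n + 1)) ≠ .rej := by simp [PowState.final]
  -- The total is 1 + n * N^n: the immediate rejection, and one term N^n for each of the n nonzero
  -- guesses.
  have hn : (n : ZMod (n + 1)) = -1 := by
    rw [eq_neg_iff_add_eq_zero]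
    exact_mod_cast ZMod.natCast_self (n + 1)
  simp [Fin.sum_univ_succ, this, h0, hn, sub_eq_add_neg]

theorem cast_modFun {p : ℕ} (hp : p.Prime) (T : NTM) (x : List Bool) :
    (modFun p T x : ZMod p) = (T.numAccept x : ZMod p) ^ (p - 1) := by
  have := Fact.mk hp
  have key : (T.numAccept x : ZMod p) = 0 ↔ T.numAccept x % p = 0 := by
    rw [ZMod.natCast_eq_zero_iff, Nat.dvd_iff_mod_eq_zero]
  by_cases h : T.numAccept x % p = 0
  -- The exponent p - 1 is positive, so the power of 0 is 0.
  · simp [modFun, h, key.2 h, Nat.sub_ne_zero_of_lt hp.one_lt]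
  · simp [modFun, h, ZMod.pow_card_sub_one_eq_one (key.not.2 h)]

end NTM

theorem mainTheorem7 (p : ℕ) (hp : p.Prime) (T : NTM) (hT : T.Halts)
    (m : ℕ → ℕ) (hTm : T.UsesMemory m)
    (hm : Asymptotics.IsBigO Filter.atTop (fun n : ℕ => Real.log (n : ℝ)) (fun n : ℕ => (m n : ℝ)))
    (f : List Bool → ℕ) (hf : f = NTM.modFun p T) :
    ∃ T' : NTM, T'.Halts ∧
      (∃ m' : ℕ → ℕ, T'.UsesMemory m' ∧
        Asymptotics.IsBigO Filter.atTop (fun n : ℕ => (m' n : ℝ)) (fun n : ℕ => (m n : ℝ))) ∧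
      f = NTM.modFun p T' ∧
      ∀ x : List Bool,
        (T'.numAccept x : ℤ) ≡ (f x : ℤ) [ZMOD (p : ℤ)] ∧
        (T'.numReject x : ℤ) ≡ 1 - (f x : ℤ) [ZMOD (p : ℤ)] := by
  obtain ⟨n, rfl⟩ : ∃ n, p = n + 1 := ⟨p - 1, (Nat.sub_add_cancel hp.one_le).symm⟩
  have hfx (x : List Bool) : (f x : ZMod (n + 1)) = (T.numAccept x : ZMod (n + 1)) ^ n := by
    rw [hf]; exact NTM.cast_modFun hp T x
  have hacc (x : List Bool) : ((T.pow n).numAccept x : ZMod (n + 1)) = f x := by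
    rw [NTM.cast_numAccept_pow hT, hfx]
  have hrej (x : List Bool) : ((T.pow n).numReject x : ZMod (n + 1)) = 1 - f x := by
    rw [NTM.cast_numReject_pow hT, hfx]
  refine ⟨T.pow n, hT.pow n, ⟨_, hTm.pow n, ?_⟩, ?_, fun x => ⟨?_, ?_⟩⟩
  · simpa using (Asymptotics.isBigO_refl (fun n : ℕ => (m n : ℝ)) Filter.atTop).const_mul_left
      ((n : ℝ) + 1)
  · funext x
    have h1 : (T.pow n).numAccept x % (n + 1) = f x % (n + 1) :=
      (ZMod.natCast_eq_natCast_iff' _ _ _).1 (hacc x)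
    -- Both values are below p, so the congruence determines `f x`.
    have h2 : f x = 0 ∨ f x = 1 := by
      rw [hf, NTM.modFun]; split_ifs <;> simp
    have h3 : 1 % (n + 1) = 1 := Nat.mod_eq_of_lt hp.one_lt
    rw [NTM.modFun, h1]
    rcases h2 with h2 | h2 <;> simp [h2, h3]
  · rw [← ZMod.intCast_eq_intCast_iff]
    simpa using hacc x
  · rw [← ZMod.intCast_eq_intCast_iff]
    simpa using hrej x
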